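/- Let $C\subset[0,1]$ be the ternary Cantor set and let $D$ be its Alexandroff double: $D=C\times\{0,1\}$, where every point $(x,1)$ is isolated and the basic neighbourhoods of $(x,0)$ are the sets $(U\times\{0,1\})\setminus\{(x,1)\}$ with $U$ an open neighbourhood of $x$ in $C$. A compact space is called uniform Eberlein if it is homeomorphic to a subset of a Hilbert space with its weak topology. For a set $\Gamma$ put $\sigma_1(\Gamma)=\{x\in\{0,1\}^\Gamma : |\{\gamma : x_\gamma\neq 0\}|\le 1\}$, with the topology inherited from the product $\{0,1\}^\Gamma$, and let $\sigma_1(\Gamma)^\omega$ be its countable power with the product topology. 1. Let $\Gamma=C\cup\{2\}$ and, for $x\in C$ and $i\in\{0,1\}$, define $f_{x,i}:\Gamma\to[0,1]$ by $f_{x,i}(2)=x$, $f_{x,i}(x)=i$ and $f_{x,i}(\gamma)=0$ for $\gamma\in C\setminus\{x\}$. Then $(x,i)\mapsto f_{x,i}$ is a homeomorphic embedding of $D$ into $[0,1]^\Gamma$. The points $(x,1)$ are isolated in $D$ and the points $(x,0)$ are not. 2. $D$ is a uniform Eberlein compactum, and its weight is the continuum $\mathfrak c$. 3. For no set $\Gamma$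 (of any cardinality $\kappa$) is $D$ a continuous image of $\sigma_1(\Gamma)^\omega$. 4. Consequently, the question of Benyamini, Rudin and Wage has a negative answer: it is not true that, for every infinite cardinal $\kappa$, every nonempty uniform Eberlein compactum of weight at most $\kappa$ is a continuous image of $\sigma_1(\kappa)^\omega$. -/

import Mathlib

open Topology Cardinal

universe u v

/-- The underlying set of the Alexandroff double of `X`, that is, `X × {0, 1}`; the level `false`
stands for `0` and the level `true` for `1`. -/
@[ext] structure AlexandroffDouble (X : Type u) : Type u where
  point : X
  level : Bool

/-- The topology of the Alexandroff double: each `(x, 1)` is isolated, and the basic neighbourhoods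
of `(x, 0)` are the sets `(U × {0, 1}) \ {(x, 1)}` with `U` an open neighbourhood of `x`. -/
instance AlexandroffDouble.instTopologicalSpace (X : Type u) [TopologicalSpace X] :
    TopologicalSpace (AlexandroffDouble X) where
  IsOpen S := ∀ x : X, (⟨x, false⟩ : AlexandroffDouble X) ∈ S →
    ∃ U : Set X, IsOpen U ∧ x ∈ U ∧
      {p : AlexandroffDouble X | p.point ∈ U} \ {⟨x, true⟩} ⊆ S
  isOpen_univ := fun x _ => ⟨Set.univ, isOpen_univ, Set.mem_univ x, Set.subset_univ _⟩
  isOpen_inter := by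
    intro S T hS hT x hx
    obtain ⟨U, hU, hxU, hUS⟩ := hS x hx.1
    obtain ⟨V, hV, hxV, hVT⟩ := hT x hx.2
    exact ⟨U ∩ V, hU.inter hV, ⟨hxU, hxV⟩,
      fun p hp => ⟨hUS ⟨hp.1.1, hp.2⟩, hVT ⟨hp.1.2, hp.2⟩⟩⟩
  isOpen_sUnion := by
    intro A hA x hx
    obtain ⟨S, hSA, hxS⟩ := hx
    obtain ⟨U, hU, hxU, hUS⟩ := hA S hSA x hxS
    exact ⟨U, hU, hxU, fun p hp => ⟨S, hSA, hUS hp⟩⟩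

/-- `X` is uniform Eberlein compact: it is compact and homeomorphic to a subset of a Hilbert space
with its weak topology. -/
def IsUniformEberlein (X : Type u) [TopologicalSpace X] : Prop :=
  CompactSpace X ∧
    ∃ (H : Type u) (_ : NormedAddCommGroup H) (_ : InnerProductSpace ℝ H) (_ : CompleteSpace H)
      (f : X → WeakSpace ℝ H), IsEmbedding f

/-- `σ_n(Γ)`: the points of `{0, 1}^Γ` with at most `n` nonzero coordinates. It carries the subspace
topology from the product of discrete two-point spaces. -/
def sigmaSpace (n : ℕ) (Γ : Type u) : Set (Γ → Fin 2) :=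
  {x | {γ | x γ ≠ 0}.encard ≤ n}

/-- `X` is a continuous image of `Y`. -/
def IsContinuousImageOf (X : Type u) (Y : Type v) [TopologicalSpace X] [TopologicalSpace Y] :
    Prop :=
  ∃ f : Y → X, Continuous f ∧ Function.Surjective f

/-- The weight of a topological space: the least cardinality of a base. -/
noncomputable def topWeight (X : Type u) [TopologicalSpace X] : Cardinal.{u} :=
  sInf {c | ∃ B : Set (Set X), TopologicalSpace.IsTopologicalBasis B ∧ #B = c}

/-- The Alexandroff double `D` of the (ternary) Cantor set `C ⊆ [0, 1]`. -/
abbrev CantorDouble : Type := AlexandroffDouble cantorSet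

open Classical in
/-- The map `(x, i) ↦ f_{x,i}` from `D` to `[0, 1]^Γ`, where `Γ = C ∪ {2}`: the coordinate of
`f_{x,i}` at `2` is `x`, the coordinate at `x` is `i`, and all other coordinates are `0`. -/
noncomputable def cantorDoubleMap (p : CantorDouble) :
    ↥(cantorSet ∪ {2} : Set ℝ) → Set.Icc (0 : ℝ) 1 := fun γ =>
  if (γ : ℝ) = 2 then ⟨p.point, cantorSet_subset_unitInterval p.point.2⟩
  else if (γ : ℝ) = p.point ∧ p.level = true then 1
  else 0

open Filter Set

/-! ### Topology of the double. -/

namespace AlexandroffDouble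

variable {X : Type u} [TopologicalSpace X]

/-! Suppose `f` maps `σ₁(Γ)^ω` onto `D`. As `(x, 1)` is isolated, finitely many coordinates of a
preimage already force the value `(x, 1)`, and uncountably many `x` share one finite set `J` of
them. On a smaller uncountable set each coordinate in `J` is constant or injective, and injective
families in `σ₁(Γ)` tend to `0`. With `0` put outside `J`, the preimages converge along the cofinite
filter, hence so do the points `x` in `C`. First countability of `C` forbids this
(`countable_of_injective_of_tendsto_cofinite`).

For both embeddings, `D` is compact, so a continuous injection into a Hausdorff space suffices;
continuity rests on `continuous_ite_level`. -/

theorem isOpen_iff {S : Set (AlexandroffDouble X)} :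
    IsOpen S ↔ ∀ x : X, (⟨x, false⟩ : AlexandroffDouble X) ∈ S →
      ∃ U : Set X, IsOpen U ∧ x ∈ U ∧
        {p : AlexandroffDouble X | p.point ∈ U} \ {⟨x, true⟩} ⊆ S :=
  Iff.rfl

theorem isOpen_singleton_true (x : X) : IsOpen ({⟨x, true⟩} : Set (AlexandroffDouble X)) := by
  rw [isOpen_iff]
  intro y hy
  simp at hy

theorem isOpen_diff_singleton_true {U : Set X} (hU : IsOpen U) (x : X) [T1Space X] :
    IsOpen ({p : AlexandroffDouble X | p.point ∈ U} \ {⟨x, true⟩}) := by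
  rw [isOpen_iff]
  intro y hy
  rcases eq_or_ne y x with rfl | hne
  · exact ⟨U, hU, hy.1, subset_rfl⟩
  · refine ⟨U \ {x}, hU.sdiff isClosed_singleton, ⟨hy.1, hne⟩, fun p hp => ⟨hp.1.1, ?_⟩⟩
    rintro rfl
    exact hp.1.2 rfl

theorem mem_nhds_false [T1Space X] {x : X} {S : Set (AlexandroffDouble X)} :
    S ∈ 𝓝 (⟨x, false⟩ : AlexandroffDouble X) ↔ ∃ U : Set X, IsOpen U ∧ x ∈ U ∧
      {p : AlexandroffDouble X | p.point ∈ U} \ {⟨x, true⟩} ⊆ S := by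
  constructor
  · intro h
    obtain ⟨T, hTS, hT, hx⟩ := mem_nhds_iff.1 h
    obtain ⟨U, hU, hxU, hUT⟩ := isOpen_iff.1 hT x hx
    exact ⟨U, hU, hxU, hUT.trans hTS⟩
  · rintro ⟨U, hU, hxU, hUS⟩
    exact mem_of_superset ((isOpen_diff_singleton_true hU x).mem_nhds ⟨hxU, by simp⟩) hUS

theorem nhds_true (x : X) : 𝓝 (⟨x, true⟩ : AlexandroffDouble X) = pure ⟨x, true⟩ :=
  (isOpen_singleton_iff_nhds_eq_pure _).1 (isOpen_singleton_true x)

theorem continuous_point : Continuous (point : AlexandroffDouble X → X) where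
  isOpen_preimage U hU := isOpen_iff.2 fun _ hx => ⟨U, hU, hx, fun _ hp => hp.1⟩

theorem continuous_ite_level [T1Space X] {E : Type*} [TopologicalSpace E] [Zero E] {c : X → E}
    (hc : Tendsto c cofinite (𝓝 0)) :
    Continuous fun p : AlexandroffDouble X => if p.level = true then c p.point else 0 := by
  rw [continuous_iff_continuousAt]
  rintro ⟨x, _ | _⟩
  · intro V hV
    simp only [Bool.false_eq_true, if_false] at hV
    have hfin : {y | c y ∉ V}.Finite := hc hV
    -- The point `x` may be bad too, but it must stay in `U`; the neighbourhood omits `(x, true)`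
    -- anyway.
    refine mem_nhds_false.2 ⟨({y | c y ∉ V} \ {x})ᶜ,
      (hfin.subset sdiff_subset).isClosed.isOpen_compl, by simp, ?_⟩
    rintro ⟨y, _ | _⟩ ⟨hy, hne⟩
    · simpa using mem_of_mem_nhds hV
    · by_contra hyV
      refine hy ⟨by simpa using hyV, fun hyx => hne ?_⟩
      obtain rfl : y = x := hyx
      rfl
  · rw [ContinuousAt, nhds_true]
    exact tendsto_pure_nhds _ _

instance [T1Space X] [CompactSpace X] : CompactSpace (AlexandroffDouble X) := by
  rw [← isCompact_univ_iff, isCompact_iff_ultrafilter_le_nhds]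
  intro F _
  obtain ⟨x, -, hx⟩ := isCompact_iff_ultrafilter_le_nhds.1 (isCompact_univ (X := X))
    (F.map point) (by simp)
  -- An ultrafilter lying over `x` is either principal at `(x, 1)` or converges to `(x, 0)`.
  by_cases h : ({⟨x, true⟩} : Set (AlexandroffDouble X)) ∈ F
  · exact ⟨⟨x, true⟩, mem_univ _, by rw [nhds_true]; simpa using h⟩
  · refine ⟨⟨x, false⟩, mem_univ _, fun S hS => ?_⟩
    obtain ⟨U, hU, hxU, hUS⟩ := mem_nhds_false.1 hS
    exact mem_of_superset (inter_mem (hx (hU.mem_nhds hxU)) (Ultrafilter.compl_mem_iff_notMem.2 h))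
      hUS

theorem not_isOpen_singleton_false {x : X} (hx : ¬ IsOpen ({x} : Set X)) :
    ¬ IsOpen ({⟨x, false⟩} : Set (AlexandroffDouble X)) := by
  intro h
  obtain ⟨U, hU, hxU, hUS⟩ := isOpen_iff.1 h x rfl
  refine hx ?_
  convert hU
  refine Subset.antisymm (singleton_subset_iff.2 hxU) fun y hy => ?_
  have := @hUS ⟨y, false⟩ ⟨hy, by simp⟩
  simpa using this

/-- The Alexandroff double of a compact subset of the line is uniform Eberlein compact: send
`(x, i)` to `x e₀ + i eₓ` in a Hilbert space with orthonormal basis indexed by `{0} ⊔ X`. -/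
theorem isUniformEberlein {s : Set ℝ} (hs : IsCompact s) :
    IsUniformEberlein (AlexandroffDouble s) := by
  classical
  have : CompactSpace s := isCompact_iff_compactSpace.1 hs
  let H := lp (fun _ : Option s => ℝ) 2
  let e : Option s → H := fun i => lp.single 2 i (1 : ℝ)
  let g : AlexandroffDouble s → H := fun p =>
    (p.point : ℝ) • e none + (if p.level = true then e (some p.point) else 0)
  let f : AlexandroffDouble s → WeakSpace ℝ H := fun p => toWeakSpace ℝ H (g p)
  have hf : Continuous f := by
    refine WeakBilin.continuous_of_continuous_eval _ fun φ => ?_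
    let v : H := (InnerProductSpace.toDual ℝ H).symm φ
    have hφ : ∀ i, φ (e i) = v i := fun i => by
      rw [← InnerProductSpace.toDual_symm_apply (𝕜 := ℝ)]
      exact (lp.inner_single_right (𝕜 := ℝ) i (1 : ℝ) v).trans (one_mul (v i))
    -- Square summability of the Riesz vector `v` of `φ` gives the decay that `continuous_ite_level`
    -- needs.
    have hv : Tendsto (fun x : s => v (some x)) cofinite (𝓝 0) := by
      have h2 : Summable fun i => ‖v i‖ ^ (2 : ℝ) := by
        simpa using (lp.memℓp v).summable (by norm_num)
      have h3 := (h2.tendsto_cofinite_zero.comp (Option.some_injective s).tendsto_cofinite)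
      have h4 := h3.sqrt
      simp only [Real.sqrt_zero] at h4
      refine squeeze_zero_norm (fun x => ?_) h4
      simp [Real.sqrt_sq_eq_abs]
    have hcont : Continuous fun p : AlexandroffDouble s =>
        (p.point : ℝ) * v none + (if p.level = true then v (some p.point) else 0) :=
      ((continuous_subtype_val.comp continuous_point).mul continuous_const).add
        (continuous_ite_level hv)
    convert hcont using 2 with p
    change φ (g p) = _
    simp only [g, map_add, map_smul, hφ, smul_eq_mul]
    split_ifs <;> simp [hφ]
  have hg : ∀ (r : AlexandroffDouble s) (i : Option s), g r i =
      r.point * e none i + (if r.level = true then e (some r.point) i else 0) := by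
    intro r i
    change (r.point : ℝ) * e none i +
      (if r.level = true then e (some r.point) else 0 : H) i = _
    split_ifs <;> rfl
  have hinj : Function.Injective f := by
    intro p q hpq
    have hpq : g p = g q := (toWeakSpace ℝ H).injective hpq
    have key : ∀ i, g p i = g q i := fun i => by rw [hpq]
    have hpt : p.point = q.point := by
      have := key none
      have hz : ∀ r : AlexandroffDouble s, g r none = r.point := by
        intro r
        rw [hg]
        simp [e, lp.single_apply]
      rw [hz, hz] at this
      exact Subtype.ext this
    have hlv : ∀ r : AlexandroffDouble s, g r (some r.point) = if r.level = true then 1 else 0 := by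
      intro r
      rw [hg]
      simp [e, lp.single_apply]
    have h1 := key (some p.point)
    rw [hlv, hpt, hlv] at h1
    refine AlexandroffDouble.ext hpt ?_
    cases hp : p.level <;> cases hq : q.level <;> simp_all
  exact ⟨inferInstance, H, inferInstance, inferInstance, inferInstance, f,
    (hf.isClosedEmbedding hinj).isEmbedding⟩

/-- Every base contains the singleton of each isolated point. -/
theorem le_topWeight : #X ≤ topWeight (AlexandroffDouble X) := by
  refine le_csInf ⟨_, _, TopologicalSpace.isTopologicalBasis_opens, rfl⟩ ?_
  rintro _ ⟨B, hB, rfl⟩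
  have hmem : ∀ x : X, ({⟨x, true⟩} : Set (AlexandroffDouble X)) ∈ B := fun x => by
    obtain ⟨V, hV, hxV, hVx⟩ := hB.exists_subset_of_mem_open (mem_singleton _)
      (isOpen_singleton_true x)
    rwa [← Subset.antisymm hVx (singleton_subset_iff.2 hxV)]
  refine Cardinal.mk_le_of_injective (f := fun x : X => (⟨_, hmem x⟩ : B)) fun x y hxy => ?_
  simpa using hxy

theorem topWeight_le [T1Space X] [SecondCountableTopology X] [Infinite X] :
    topWeight (AlexandroffDouble X) ≤ #X := by
  obtain ⟨b, hbc, -, hb⟩ := TopologicalSpace.exists_countable_basis X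
  let B₁ : Set (Set (AlexandroffDouble X)) := range fun x : X => {⟨x, true⟩}
  let B₂ : Set (Set (AlexandroffDouble X)) :=
    range fun q : b × X => {p | p.point ∈ (q.1 : Set X)} \ {⟨q.2, true⟩}
  have hB : TopologicalSpace.IsTopologicalBasis (B₁ ∪ B₂) := by
    refine TopologicalSpace.isTopologicalBasis_of_isOpen_of_nhds ?_ ?_
    · rintro _ (⟨x, rfl⟩ | ⟨⟨⟨U, hU⟩, x⟩, rfl⟩)
      · exact isOpen_singleton_true x
      · exact isOpen_diff_singleton_true (hb.isOpen hU) x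
    · rintro ⟨x, _ | _⟩ S hxS hS
      · obtain ⟨U, hU, hxU, hUS⟩ := isOpen_iff.1 hS x hxS
        obtain ⟨V, hV, hxV, hVU⟩ := hb.exists_subset_of_mem_open hxU hU
        exact ⟨_, Or.inr ⟨(⟨V, hV⟩, x), rfl⟩, ⟨hxV, by simp⟩,
          fun p hp => hUS ⟨hVU hp.1, hp.2⟩⟩
      · exact ⟨_, Or.inl ⟨x, rfl⟩, rfl, singleton_subset_iff.2 hxS⟩
  have hX : ℵ₀ ≤ #X := Cardinal.aleph0_le_mk X
  calc topWeight (AlexandroffDouble X) ≤ #(B₁ ∪ B₂ : Set _) := csInf_le' ⟨_, hB, rfl⟩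
    _ ≤ #B₁ + #B₂ := Cardinal.mk_union_le _ _
    _ ≤ #X + #(b × X) := add_le_add Cardinal.mk_range_le Cardinal.mk_range_le
    _ = #X + #b * #X := by simp
    _ ≤ #X + #X * #X := by
        gcongr
        exact (Cardinal.mk_le_aleph0_iff.2 hbc.to_subtype).trans hX
    _ = #X := by rw [Cardinal.mul_eq_self hX, Cardinal.add_eq_self hX]

end AlexandroffDouble

/-! ### The Cantor set and the explicit embedding. -/

theorem not_isOpen_singleton_nat_bool (a : ℕ → Bool) : ¬ IsOpen ({a} : Set (ℕ → Bool)) := by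
  intro h
  have ht : Tendsto (fun n => Function.update a n (!a n)) atTop (𝓝 a) := by
    refine tendsto_pi_nhds.2 fun i => tendsto_nhds_of_eventually_eq ?_
    filter_upwards [eventually_gt_atTop i] with n hn
    exact Function.update_of_ne hn.ne _ _
  obtain ⟨n, hn⟩ := (ht.eventually (h.mem_nhds rfl)).exists
  have := congrFun (mem_singleton_iff.1 hn) n
  simp at this

theorem not_isOpen_singleton_cantorSet (x : cantorSet) : ¬ IsOpen ({x} : Set cantorSet) := by
  intro h
  refine not_isOpen_singleton_nat_bool (cantorSetHomeomorphNatToBool x) ?_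
  simpa using cantorSetHomeomorphNatToBool.isOpenMap _ h

theorem mk_cantorSet : #cantorSet = 𝔠 := by
  rw [Cardinal.mk_congr cantorSetEquivNatToBool]
  simp

instance : Uncountable cantorSet := by
  rw [← Cardinal.aleph0_lt_mk_iff, mk_cantorSet]
  exact Cardinal.aleph0_lt_continuum

instance : CompactSpace cantorSet := isCompact_iff_compactSpace.1 isCompact_cantorSet

theorem isEmbedding_cantorDoubleMap : IsEmbedding cantorDoubleMap := by
  classical
  have hne2 : ∀ x : cantorSet, (x : ℝ) ≠ 2 := fun x h => by
    have := (cantorSet_subset_unitInterval x.2).2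
    rw [h] at this
    norm_num at this
  have hcont : Continuous cantorDoubleMap := by
    refine continuous_pi fun γ => ?_
    by_cases hγ : (γ : ℝ) = 2
    · simp only [cantorDoubleMap, if_pos hγ]
      exact (continuous_subtype_val.comp AlexandroffDouble.continuous_point).subtype_mk _
    · have hγC : (γ : ℝ) ∈ cantorSet := γ.2.resolve_right hγ
      have hc : Tendsto (fun x : cantorSet => if (γ : ℝ) = x then (1 : Icc (0 : ℝ) 1) else 0)
          cofinite (𝓝 0) := by
        refine tendsto_nhds_of_eventually_eq ?_
        filter_upwards [(finite_singleton (⟨γ, hγC⟩ : cantorSet)).compl_mem_cofinite] with x hx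
        exact if_neg fun h => hx (Subtype.ext h.symm)
      convert AlexandroffDouble.continuous_ite_level hc using 2 with p
      simp only [cantorDoubleMap, if_neg hγ]
      split_ifs <;> simp_all
  have hinj : Function.Injective cantorDoubleMap := by
    intro p q hpq
    have hpt : p.point = q.point := by
      have := congrFun hpq ⟨2, Or.inr rfl⟩
      simpa [cantorDoubleMap, Subtype.ext_iff] using this
    have h1 := congrFun hpq ⟨p.point, Or.inl p.point.2⟩
    refine AlexandroffDouble.ext hpt ?_
    cases hp : p.level <;> cases hq : q.level <;> simp_all [cantorDoubleMap]
  exact (hcont.isClosedEmbedding hinj).isEmbedding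

/-- Every map on an uncountable set is constant or injective on an uncountable subset. -/
theorem Set.exists_not_countable_subset_const_or_injOn {α : Type*} {β : Type*} {T : Set α}
    (hT : ¬ T.Countable) (h : α → β) :
    ∃ T' ⊆ T, ¬ T'.Countable ∧ ((∃ b, ∀ t ∈ T', h t = b) ∨ InjOn h T') := by
  by_cases hb : ∃ b, ¬ (T ∩ h ⁻¹' {b}).Countable
  · obtain ⟨b, hb⟩ := hb
    exact ⟨_, inter_subset_left, hb, Or.inl ⟨b, fun t ht => ht.2⟩⟩
  · push Not at hb
    -- All fibres are countable here, so a countable transversal `T'` would make `T` countable.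
    obtain ⟨T', hT', hbij⟩ := exists_subset_bijOn T h
    refine ⟨T', hT', fun hc => hT ?_, Or.inr hbij.injOn⟩
    have himg : (h '' T).Countable := hbij.image_eq ▸ hc.image h
    refine (himg.biUnion fun b _ => hb b).mono fun t ht => ?_
    exact mem_biUnion (mem_image_of_mem h ht) ⟨ht, rfl⟩

/-- Both alternatives pass to subsets, so `T` can be thinned one index at a time. -/
theorem Set.exists_not_countable_subset_forall_const_or_injOn {α ι : Type*} {β : ι → Type*}
    (h : ∀ i, α → β i) (I : Finset ι) {T : Set α} (hT : ¬ T.Countable) :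
    ∃ T' ⊆ T, ¬ T'.Countable ∧ ∀ i ∈ I, (∃ b, ∀ t ∈ T', h i t = b) ∨ InjOn (h i) T' := by
  classical
  induction I using Finset.induction_on with
  | empty => exact ⟨T, subset_rfl, hT, by simp⟩
  | insert i I _ ih =>
    obtain ⟨T₁, hT₁, hc₁, h₁⟩ := ih
    obtain ⟨T₂, hT₂, hc₂, h₂⟩ := exists_not_countable_subset_const_or_injOn hc₁ (h i)
    refine ⟨T₂, hT₂.trans hT₁, hc₂, fun j hj => ?_⟩
    rcases Finset.mem_insert.1 hj with rfl | hj
    · exact h₂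
    · exact (h₁ j hj).imp (fun ⟨b, hb⟩ => ⟨b, fun t ht => hb t (hT₂ ht)⟩) fun hi => hi.mono hT₂

/-- An injective family in `σ₁(Γ)` converges to `0` along the cofinite filter. -/
theorem tendsto_cofinite_sigmaSpace_one {α : Type*} {Γ : Type u} {h : α → sigmaSpace 1 Γ}
    (hh : Function.Injective h) :
    Tendsto h cofinite (𝓝 ⟨0, by simp [sigmaSpace]⟩) := by
  rw [tendsto_subtype_rng, tendsto_pi_nhds]
  intro γ
  refine tendsto_nhds_of_eventually_eq ?_
  -- Only one point of `σ₁(Γ)` is nonzero at `γ`: the indicator of `γ`.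
  have hsub : {t | (h t : Γ → Fin 2) γ ≠ 0}.Subsingleton := by
    intro s hs t ht
    refine hh (Subtype.ext (funext fun δ => ?_))
    have hz : ∀ r, (h r : Γ → Fin 2) γ ≠ 0 → δ ≠ γ → (h r : Γ → Fin 2) δ = 0 := by
      intro r hr hδ
      by_contra hne
      have hle : {γ | (h r : Γ → Fin 2) γ ≠ 0}.encard ≤ 1 := by exact_mod_cast (h r).2
      exact hδ (encard_le_one_iff.1 hle _ _ hne hr)
    by_cases hδ : δ = γ
    · subst hδ
      have hs' : (h s : Γ → Fin 2) δ ≠ 0 := hs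
      have ht' : (h t : Γ → Fin 2) δ ≠ 0 := ht
      omega
    · rw [hz s hs hδ, hz t ht hδ]
  exact hsub.finite

/-- In a first countable T₁ space, an injective family that converges along the cofinite filter is
countable. -/
theorem countable_of_injective_of_tendsto_cofinite {α X : Type*} [TopologicalSpace X] [T1Space X]
    [FirstCountableTopology X] {f : α → X} (hf : Function.Injective f) {x : X}
    (hx : Tendsto f cofinite (𝓝 x)) : Countable α := by
  obtain ⟨U, hU⟩ := (𝓝 x).exists_antitone_basis
  -- Each `U n` misses finitely many `f t`; outside this countable union `f t` lies in every `U n`,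
  -- so equals `x`.
  have hcount : (⋃ n, {t | f t ∉ U n}).Countable :=
    countable_iUnion fun n => (hx (hU.1.mem_of_mem trivial) : {t | f t ∈ U n}ᶜ.Finite).countable
  have hsub : {t | f t = x}.Subsingleton := fun s hs t ht => hf (hs.trans ht.symm)
  refine countable_univ_iff.1 ((hcount.union hsub.finite.countable).mono fun t _ => ?_)
  by_contra ht
  simp only [mem_union, mem_iUnion, mem_ofPred_eq, not_or, not_exists, not_not] at ht
  have hmem : x ∈ ({f t}ᶜ : Set X) := fun h => ht.2 h.symm
  obtain ⟨n, -, hn⟩ := hU.1.mem_iff.1 (isOpen_compl_singleton.mem_nhds hmem)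
  exact hn (ht.1 n) rfl

theorem AlexandroffDouble.not_isContinuousImageOf_sigmaSpace_one {X : Type v} [TopologicalSpace X]
    [T1Space X] [FirstCountableTopology X] [Uncountable X] (Γ : Type u) :
    ¬ IsContinuousImageOf (AlexandroffDouble X) (ℕ → sigmaSpace 1 Γ) := by
  classical
  rintro ⟨f, hf, hsurj⟩
  choose y hy using fun x : X => hsurj ⟨x, true⟩
  have hbox : ∀ x : X, ∃ I : Finset ℕ, ∀ z : ℕ → sigmaSpace 1 Γ,
      (∀ i ∈ I, z i = y x i) → f z = ⟨x, true⟩ := by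
    intro x
    obtain ⟨I, u, hu, hsub⟩ := isOpen_pi_iff.1
      ((isOpen_singleton_true x).preimage hf) (y x) (hy x)
    exact ⟨I, fun z hz => hsub fun i hi => by rw [hz i hi]; exact (hu i hi).2⟩
  choose I hI using hbox
  obtain ⟨J, hJ⟩ : ∃ J : Finset ℕ, ¬ (I ⁻¹' {J}).Countable := by
    by_contra! hcon
    refine not_countable_univ (α := X) ((countable_iUnion hcon).mono fun x _ => ?_)
    simp
  obtain ⟨T, hTJ, hT, hTy⟩ :=
    Set.exists_not_countable_subset_forall_const_or_injOn (fun i x => y x i) J hJ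
  let o : sigmaSpace 1 Γ := ⟨0, by simp [sigmaSpace]⟩
  -- Coordinates outside `J` do not affect the value of `f`, so they are reset to make the family
  -- converge.
  let z : T → ℕ → sigmaSpace 1 Γ := fun t i => if i ∈ J then y t i else o
  have hfz : ∀ t, f (z t) = ⟨t, true⟩ := fun t => hI t _ fun i hi => by
    have : I t = J := hTJ t.2
    exact if_pos (this ▸ hi)
  have hlim : ∀ i, ∃ a, Tendsto (fun t => z t i) cofinite (𝓝 a) := by
    intro i
    by_cases hi : i ∈ J
    · simp only [z, if_pos hi]
      rcases hTy i hi with ⟨b, hb⟩ | hinj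
      · exact ⟨b, tendsto_nhds_of_eventually_eq (Eventually.of_forall fun t => hb t t.2)⟩
      · exact ⟨_, tendsto_cofinite_sigmaSpace_one (injOn_iff_injective.1 hinj)⟩
    · simp only [z, if_neg hi]
      exact ⟨o, tendsto_const_nhds⟩
  choose a ha using hlim
  have hconv : Tendsto (fun t => (f (z t)).point) cofinite (𝓝 (f a).point) :=
    ((continuous_point.comp hf).tendsto a).comp (tendsto_pi_nhds.2 ha)
  simp only [hfz] at hconv
  exact hT (countable_of_injective_of_tendsto_cofinite Subtype.val_injective hconv)

theorem mainTheorem7 :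
    -- the explicit embedding of `D` into `[0, 1]^Γ`
    IsEmbedding cantorDoubleMap ∧
    -- the points `(x, 1)` are isolated and the points `(x, 0)` are not
    (∀ x : cantorSet, IsOpen ({⟨x, true⟩} : Set CantorDouble) ∧
      ¬ IsOpen ({⟨x, false⟩} : Set CantorDouble)) ∧
    -- `D` is a uniform Eberlein compactum, and its weight is the continuum
    IsUniformEberlein CantorDouble ∧
    topWeight CantorDouble = 𝔠 ∧
    -- `D` is not a continuous image of any `σ₁(κ)^ω`
    (∀ Γ : Type u, ¬ IsContinuousImageOf CantorDouble (ℕ → sigmaSpace 1 Γ)) ∧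
    -- so not every nonempty uniform Eberlein compactum of weight at most `κ` is a continuous
    -- image of `σ₁(κ)^ω`
    ¬ (∀ (Γ : Type) [Infinite Γ] (K : Type) [TopologicalSpace K] [Nonempty K],
        IsUniformEberlein K → topWeight K ≤ #Γ →
          IsContinuousImageOf K (ℕ → sigmaSpace 1 Γ)) := by
  have hEb : IsUniformEberlein CantorDouble :=
    AlexandroffDouble.isUniformEberlein isCompact_cantorSet
  have hle : topWeight CantorDouble ≤ #cantorSet := AlexandroffDouble.topWeight_le
  refine ⟨isEmbedding_cantorDoubleMap, fun x => ⟨AlexandroffDouble.isOpen_singleton_true x,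
    AlexandroffDouble.not_isOpen_singleton_false (not_isOpen_singleton_cantorSet x)⟩, hEb,
    mk_cantorSet ▸ hle.antisymm AlexandroffDouble.le_topWeight,
    fun Γ => AlexandroffDouble.not_isContinuousImageOf_sigmaSpace_one Γ, fun h => ?_⟩
  have : Nonempty CantorDouble := ⟨⟨⟨0, zero_mem_cantorSet⟩, false⟩⟩
  -- The counterexample is at `κ = 𝔠`, with `C` itself as index set.
  exact AlexandroffDouble.not_isContinuousImageOf_sigmaSpace_one cantorSet
    (h cantorSet CantorDouble hEb hle)
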